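/- Let $p\ge 6$ be an integer and let $R\in\mathbb R$. There is a constant $C$ depending only on $p$ and $R$ such that the following holds for every $n\ge 1$. Let $z\sim\mathcal N(0,\Pi)$ be a centered Gaussian vector in $\mathbb R^n$ whose (possibly singular) covariance matrix $\Pi\in\mathbb R^{n\times n}$ has nonzero diagonal entries and satisfies $$\sum_{1\le i<j\le n}\frac{\Pi_{ij}^2}{\Pi_{ii}\Pi_{jj}}\le R .$$ Let $\phi_1,\dots,\phi_n:\mathbb R\to\mathbb R$ be measurable functions with means $\mu_i=\mathbb E\,\phi_i(z_i)$ and finite centered moments $\mathbb E(\phi_i(z_i)-\mu_i)^{2p}<\infty$, and put $Q=\frac1n\sum_{i=1}^n\phi_i(z_i)$. Then $Q$ is integrable, its $2p$-th centered moment is finite, and $$\mathbb E\big[(Q-\mathbb EQ)^{2p}\big]\le C\,n^{-1.5}\max_{1\le i\le n}\mathbb E\,(\phi_i(z_i)-\mu_i)^{2p}.$$ If in addition $\mathbb E|\phi_i(z_i)-\mu_i|^{2pL}<\infty$ for all $i$ and some real $L>1$, then, with the same constant $C$, $$\mathbb E\big[(Q-\mathbb EQ)^{2p}\big]\le C\,n^{-1.5+1/L}\left(\frac1n\sum_{i=1}^n\mathbb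 E\,|\phi_i(z_i)-\mu_i|^{2pL}\right)^{1/L}.$$ -/

import Mathlib

open MeasureTheory ProbabilityTheory

/-! Expand the `2p`-th power of the sum of the centered variables over index tuples `t : Fin (2 * p)
→ Fin n`. Tuples missing at least two distinct values number `O(n ^ (2p - 2))`
(`card_filter_card_image_add_two_le`), and each contributes a bounded amount once the moments are
normalized. Every other tuple has at most one repetition, so at least `2p - 2 ≥ 3` of its indices
occur exactly once and carry a centered factor.

For those tuples the mixed moment is of second order in the correlations
(`exists_abs_integral_prod_tuple_le`). When the correlations are small, the normalized subvector has
density proportional to `exp q` with respect to the standard Gaussian, `q` a small quadratic form.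
In `exp q = 1 + q + O(q ^ 2)` the terms `1` and `q` integrate to zero: a monomial `y i * y j`
involves at most two coordinates, so some centered factor stays independent of it. The remainder is
controlled by Cauchy–Schwarz (`exists_abs_integral_prod_le_of_exp_quadratic`). When the correlations
are not small, the trivial moment bound suffices; hence a singular covariance does no harm.

Summing the squared correlations over tuples fixes two indices and frees the other `2p - 2`
(`sum_tuple_eval_two`), which gives `O((1 + R) n ^ (2p - 2))`. Division by `n ^ (2p)` yields order
`n ^ (-2)`, stronger than required. The second inequality follows by Jensen, and by bounding a
maximum by a sum. -/

/-! ### Gaussian densities and linear changes of variables -/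

theorem pi_gaussianReal_eq_withDensity (ι : Type*) [Fintype ι] :
    Measure.pi (fun _ : ι => gaussianReal 0 1) =
      volume.withDensity (fun x : ι → ℝ =>
        ENNReal.ofReal ((√(2 * Real.pi))⁻¹ ^ Fintype.card ι * Real.exp (-(∑ i, x i ^ 2) / 2))) := by
  have hf : ∀ x : ι → ℝ, (√(2 * Real.pi))⁻¹ ^ Fintype.card ι * Real.exp (-(∑ i, x i ^ 2) / 2)
      = ∏ i, gaussianPDFReal 0 1 (x i) := by
    intro x
    simp only [gaussianPDFReal, NNReal.coe_one, mul_one, sub_zero]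
    rw [Finset.prod_mul_distrib, Finset.prod_const, ← Real.exp_sum, Finset.card_univ,
      ← Finset.sum_div, Finset.sum_neg_distrib]
  simp_rw [hf]
  symm
  refine (Measure.pi_eq fun s hs => ?_).symm
  rw [withDensity_apply _ (MeasurableSet.univ_pi hs)]
  have h1 : ∀ x : ι → ℝ, (Set.univ.pi s).indicator (fun x => ∏ i, gaussianPDFReal 0 1 (x i)) x
      = ∏ i, (s i).indicator (gaussianPDFReal 0 1) (x i) := by
    intro x
    by_cases hx : x ∈ Set.univ.pi s
    · rw [Set.indicator_of_mem hx]
      exact Finset.prod_congr rfl fun i _ => (Set.indicator_of_mem (hx i trivial) _).symm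
    · rw [Set.indicator_of_notMem hx]
      simp only [Set.mem_pi, Set.mem_univ, true_implies, not_forall] at hx
      obtain ⟨i, hi⟩ := hx
      exact (Finset.prod_eq_zero (Finset.mem_univ i) (Set.indicator_of_notMem hi _)).symm
  have hint : ∀ i, Integrable ((s i).indicator (gaussianPDFReal 0 1)) := fun i =>
    (integrable_gaussianPDFReal 0 1).indicator (hs i)
  have hnn : ∀ i x, 0 ≤ (s i).indicator (gaussianPDFReal 0 1) x := fun i x =>
    Set.indicator_nonneg (fun y _ => gaussianPDFReal_nonneg 0 1 y) x
  rw [← lintegral_indicator (MeasurableSet.univ_pi hs)]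
  have h2 : ∀ x : ι → ℝ, (Set.univ.pi s).indicator
      (fun x => ENNReal.ofReal (∏ i, gaussianPDFReal 0 1 (x i))) x
      = ENNReal.ofReal (∏ i, (s i).indicator (gaussianPDFReal 0 1) (x i)) := by
    intro x
    rw [← h1 x]
    by_cases hx : x ∈ Set.univ.pi s <;> simp [hx]
  simp_rw [h2]
  rw [← ofReal_integral_eq_lintegral_ofReal
    (by rw [volume_pi]; exact Integrable.fintype_prod hint)
    (Filter.Eventually.of_forall fun x => Finset.prod_nonneg fun i _ => hnn i _),
    integral_fintype_prod_volume_eq_prod (fun i => (s i).indicator (gaussianPDFReal 0 1)),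
    ENNReal.ofReal_prod_of_nonneg fun i _ => integral_nonneg (hnn i)]
  refine Finset.prod_congr rfl fun i _ => ?_
  rw [gaussianReal_apply _ one_ne_zero, ofReal_integral_eq_lintegral_ofReal (hint i)
    (Filter.Eventually.of_forall (hnn i)), ← lintegral_indicator (hs i)]
  refine lintegral_congr fun x => ?_
  by_cases hx : x ∈ s i <;> simp [hx, gaussianPDF]

/-- Image of the standard Gaussian measure under an invertible matrix, as a density with respect
to the standard Gaussian measure. -/
theorem pi_gaussianReal_map_mulVec {ι : Type*} [Fintype ι] [DecidableEq ι] (T : Matrix ι ι ℝ)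
    (hT : T.det ≠ 0) :
    (Measure.pi (fun _ : ι => gaussianReal 0 1)).map T.mulVec =
      ENNReal.ofReal |T.det⁻¹| • (Measure.pi (fun _ : ι => gaussianReal 0 1)).withDensity
        (fun y => ENNReal.ofReal (Real.exp ((∑ i, y i ^ 2 - ∑ i, (T⁻¹.mulVec y) i ^ 2) / 2))) := by
  have hu : IsUnit T.det := isUnit_iff_ne_zero.2 hT
  have hm : Measurable T.mulVec := (Continuous.matrix_mulVec continuous_const continuous_id).measurable
  have hm' : Measurable T⁻¹.mulVec :=
    (Continuous.matrix_mulVec continuous_const continuous_id).measurable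
  have hinv : ∀ x, T⁻¹.mulVec (T.mulVec x) = x := fun x => by
    rw [Matrix.mulVec_mulVec, Matrix.nonsing_inv_mul _ hu, Matrix.one_mulVec]
  have hdet : LinearMap.det (Matrix.toLin' T) ≠ 0 := by rwa [LinearMap.det_toLin']
  have hvol := Real.map_linearMap_volume_pi_eq_smul_volume_pi hdet
  rw [LinearMap.det_toLin'] at hvol
  set g : (ι → ℝ) → ENNReal := fun x =>
    ENNReal.ofReal ((√(2 * Real.pi))⁻¹ ^ Fintype.card ι * Real.exp (-(∑ i, x i ^ 2) / 2)) with hg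
  have hgm : Measurable g := by fun_prop
  ext s hs
  rw [Measure.map_apply hm hs, Measure.smul_apply, withDensity_apply _ hs]
  rw [pi_gaussianReal_eq_withDensity, withDensity_apply _ (hm hs),
    setLIntegral_withDensity_eq_setLIntegral_mul _ hgm (by fun_prop) hs]
  have e1 : ∫⁻ x in T.mulVec ⁻¹' s, g x = ∫⁻ y in s, g (T⁻¹.mulVec y) ∂(volume.map T.mulVec) := by
    rw [setLIntegral_map (f := fun y => g (T⁻¹.mulVec y)) hs (hgm.comp hm') hm]
    simp_rw [hinv]
  have e2 : (volume : Measure (ι → ℝ)).map T.mulVec = ENNReal.ofReal |T.det⁻¹| • volume := hvol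
  rw [e1, e2, Measure.restrict_smul, lintegral_smul_measure]
  congr 1
  refine lintegral_congr fun y => ?_
  simp only [hg, Pi.mul_apply]
  rw [← ENNReal.ofReal_mul (by positivity), mul_assoc, ← Real.exp_add]
  congr 3
  ring

/-! ### Near isometries -/

/-- The difference is the quadratic form of `Tᵀ T - 1`; Cauchy–Schwarz over pairs of indices bounds
it by the Frobenius norm. -/
theorem abs_sum_sq_mulVec_sub_le {ι : Type*} [Fintype ι] [DecidableEq ι] {T : Matrix ι ι ℝ}
    {a : ℝ} (ha : 0 ≤ a)
    (hTa : ∑ i, ∑ j, (T.transpose * T - 1) i j ^ 2 ≤ a ^ 2) (x : ι → ℝ) :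
    |∑ i, T.mulVec x i ^ 2 - ∑ i, x i ^ 2| ≤ a * ∑ i, x i ^ 2 := by
  set B := T.transpose * T - 1 with hB
  have h1 : ∑ i, T.mulVec x i ^ 2 - ∑ i, x i ^ 2 = ∑ i, ∑ j, B i j * (x i * x j) := by
    have e1 : ∑ i, T.mulVec x i ^ 2 = x ⬝ᵥ (T.transpose * T).mulVec x := by
      rw [← Matrix.mulVec_mulVec, Matrix.dotProduct_mulVec, Matrix.vecMul_transpose]
      simp [dotProduct, sq]
    have e2 : ∑ i, x i ^ 2 = x ⬝ᵥ (1 : Matrix ι ι ℝ).mulVec x := by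
      simp [dotProduct, sq]
    rw [e1, e2, ← dotProduct_sub, ← Matrix.sub_mulVec, ← hB]
    simp only [dotProduct, Matrix.mulVec, Finset.mul_sum]
    refine Finset.sum_congr rfl fun i _ => Finset.sum_congr rfl fun j _ => by ring
  rw [h1]
  refine abs_le_of_sq_le_sq ?_ (by positivity)
  rw [← Finset.sum_product' (f := fun i j => B i j * (x i * x j))]
  refine (Finset.sum_mul_sq_le_sq_mul_sq _ _ _).trans ?_
  rw [mul_pow]
  refine mul_le_mul ?_ (le_of_eq ?_) (by positivity) (by positivity)
  · rw [Finset.sum_product]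
    exact hTa
  · rw [Finset.sum_product, sq, Finset.sum_mul_sum]
    simp_rw [mul_pow]

theorem det_ne_zero_of_near_isometry {ι : Type*} [Fintype ι] [DecidableEq ι] {T : Matrix ι ι ℝ}
    {a : ℝ} (ha : 0 ≤ a) (ha' : a < 1)
    (hTa : ∑ i, ∑ j, (T.transpose * T - 1) i j ^ 2 ≤ a ^ 2) : T.det ≠ 0 := by
  intro h
  obtain ⟨x, hx, hTx⟩ := Matrix.exists_mulVec_eq_zero_iff.2 h
  have h1 := abs_sum_sq_mulVec_sub_le ha hTa x
  rw [hTx] at h1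
  have h2 : 0 < ∑ i, x i ^ 2 := by
    obtain ⟨i, hi⟩ := Function.ne_iff.1 hx
    exact Finset.sum_pos' (fun i _ => sq_nonneg _) ⟨i, Finset.mem_univ _, by
      have : x i ≠ 0 := hi
      positivity⟩
  simp only [Pi.zero_apply, ne_eq, OfNat.ofNat_ne_zero, not_false_eq_true, zero_pow,
    Finset.sum_const_zero, zero_sub, abs_neg, abs_of_pos h2] at h1
  nlinarith

/-- The forward estimate at `T⁻¹ y` has `|T⁻¹ y|²` on the right; since `a ≤ 1 / 2`, that is at most
`2 |y|²`, whence the factor 2. This bounds the exponent of the density. -/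
theorem abs_sum_sq_sub_inv_mulVec_le {ι : Type*} [Fintype ι] [DecidableEq ι] {T : Matrix ι ι ℝ}
    {a : ℝ} (ha : 0 ≤ a) (ha' : a ≤ 1 / 2)
    (hTa : ∑ i, ∑ j, (T.transpose * T - 1) i j ^ 2 ≤ a ^ 2) (y : ι → ℝ) :
    |∑ i, y i ^ 2 - ∑ i, T⁻¹.mulVec y i ^ 2| ≤ 2 * a * ∑ i, y i ^ 2 := by
  have hdet := det_ne_zero_of_near_isometry ha (by linarith) hTa
  have h1 := abs_sum_sq_mulVec_sub_le ha hTa (T⁻¹.mulVec y)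
  rw [Matrix.mulVec_mulVec, Matrix.mul_nonsing_inv _ (isUnit_iff_ne_zero.2 hdet),
    Matrix.one_mulVec] at h1
  refine h1.trans ?_
  have h2 := (abs_le.1 h1).1
  have h3 : 0 ≤ ∑ i, T⁻¹.mulVec y i ^ 2 := by positivity
  rw [mul_comm 2 a, mul_assoc]
  refine mul_le_mul_of_nonneg_left ?_ ha
  nlinarith

/-! ### Gaussian vectors through the square root of the covariance -/

open scoped MatrixOrder in
theorem Matrix.transpose_sqrt_mul_sqrt {ι : Type*} [Fintype ι] [DecidableEq ι]
    {S : Matrix ι ι ℝ} (hS : S.PosSemidef) :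
    (CFC.sqrt S).transpose * CFC.sqrt S = S := by
  have h : (CFC.sqrt S).transpose = CFC.sqrt S := by
    have := (CFC.sqrt_nonneg S).isSelfAdjoint
    simpa [IsSelfAdjoint, Matrix.star_eq_conjTranspose] using this
  rw [h]
  exact CFC.sqrt_mul_sqrt_self _ hS.nonneg

open scoped MatrixOrder in
theorem multivariateGaussian_zero_map_ofLp {ι : Type*} [Fintype ι] [DecidableEq ι]
    (S : Matrix ι ι ℝ) :
    (multivariateGaussian 0 S).map (WithLp.ofLp) =
      (Measure.pi (fun _ : ι => gaussianReal 0 1)).map (CFC.sqrt S).mulVec := by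
  have hm : Measurable (CFC.sqrt S).mulVec :=
    (Continuous.matrix_mulVec continuous_const continuous_id).measurable
  rw [multivariateGaussian, ← map_pi_eq_stdGaussian, Measure.map_map (by fun_prop) (by fun_prop),
    Measure.map_map (by fun_prop) (by fun_prop)]
  congr 1
  ext x
  simp

/-! ### Second-order cancellation for perturbed product measures -/

theorem Real.abs_exp_sub_one_sub_le_sq_mul_exp (x : ℝ) :
    |Real.exp x - 1 - x| ≤ x ^ 2 * Real.exp |x| := by
  have h := Complex.norm_exp_sub_sum_le_norm_mul_exp (x : ℂ) 2
  simp only [Finset.sum_range_succ, Finset.range_zero, Finset.sum_empty, zero_add, pow_zero,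
    Nat.factorial, Nat.cast_one, div_one, pow_one, Complex.norm_real, Real.norm_eq_abs, sq_abs,
    mul_one] at h
  rw [← Complex.ofReal_exp, ← Complex.ofReal_one, ← Complex.ofReal_add, ← Complex.ofReal_sub,
    Complex.norm_real, Real.norm_eq_abs] at h
  rwa [sub_sub]

theorem abs_integral_mul_le_sqrt_mul_sqrt {α : Type*} {m : MeasurableSpace α} {μ : Measure α}
    {f g : α → ℝ} (hf : MemLp f 2 μ) (hg : MemLp g 2 μ) :
    |∫ x, f x * g x ∂μ| ≤ √(∫ x, f x ^ 2 ∂μ) * √(∫ x, g x ^ 2 ∂μ) := by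
  have h := integral_mul_norm_le_Lp_mul_Lq (μ := μ) (f := f) (g := g)
    Real.HolderConjugate.two_two (by simpa using hf) (by simpa using hg)
  calc |∫ x, f x * g x ∂μ| ≤ ∫ x, ‖f x‖ * ‖g x‖ ∂μ := by
        refine abs_integral_le_integral_abs.trans (le_of_eq ?_)
        simp_rw [Real.norm_eq_abs, abs_mul]
    _ ≤ _ := h
    _ = _ := by simp [Real.sqrt_eq_rpow]

theorem integrable_exp_sq_div_gaussianReal {b : ℝ} (hb : b < 1 / 2) :
    Integrable (fun x => Real.exp (b * x ^ 2)) (gaussianReal 0 1) := by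
  rw [gaussianReal_of_var_ne_zero _ one_ne_zero,
    integrable_withDensity_iff (measurable_gaussianPDF 0 1) (by simp [gaussianPDF])]
  simp only [toReal_gaussianPDF, gaussianPDFReal, NNReal.coe_one, mul_one, sub_zero]
  have h := (integrable_exp_neg_mul_sq (b := 1 / 2 - b) (by linarith)).const_mul
    (√(2 * Real.pi))⁻¹
  refine h.congr (Filter.Eventually.of_forall fun x => ?_)
  simp only
  rw [mul_left_comm, ← Real.exp_add]
  congr 2
  ring

theorem integrable_exp_sum_sq_pi_gaussianReal (ι : Type*) [Fintype ι] {b : ℝ} (hb : b < 1 / 2) :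
    Integrable (fun y : ι → ℝ => Real.exp (b * ∑ i, y i ^ 2))
      (Measure.pi (fun _ : ι => gaussianReal 0 1)) := by
  have := Integrable.fintype_prod (ι := ι) (μ := fun _ => gaussianReal 0 1)
    (fun _ => integrable_exp_sq_div_gaussianReal hb)
  simpa only [← Real.exp_sum, ← Finset.mul_sum] using this

theorem integral_exp_sum_sq_pi_gaussianReal (ι : Type*) [Fintype ι] (b : ℝ) :
    ∫ y : ι → ℝ, Real.exp (b * ∑ i, y i ^ 2) ∂(Measure.pi (fun _ : ι => gaussianReal 0 1)) =
      (∫ x, Real.exp (b * x ^ 2) ∂(gaussianReal 0 1)) ^ Fintype.card ι := by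
  rw [← integral_fintype_prod_eq_pow]
  simp only [← Real.exp_sum, ← Finset.mul_sum]

/-- If a probability measure has density proportional to `exp q` with respect to the standard
Gaussian measure, for a small quadratic form `q`, then products of one-variable functions of which
three are centered have expectation of second order in `q`. -/
theorem exists_abs_integral_prod_le_of_exp_quadratic :
    ∃ κ : ℝ, 1 ≤ κ ∧ ∀ (ι : Type) [Fintype ι] (b : ι → ι → ℝ) (a : ℝ) (k : ENNReal)
      (g : ι → ℝ → ℝ) (c : Finset ι), 0 ≤ a → a ≤ 1 / 16 →
      (∀ y : ι → ℝ, |∑ i, ∑ j, b i j * (y i * y j)| ≤ a * ∑ i, y i ^ 2) →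
      IsProbabilityMeasure (k • (Measure.pi (fun _ : ι => gaussianReal 0 1)).withDensity
        (fun y => ENNReal.ofReal (Real.exp (∑ i, ∑ j, b i j * (y i * y j))))) →
      (∀ i, MemLp (g i) 2 (gaussianReal 0 1)) → 3 ≤ c.card →
      (∀ i ∈ c, ∫ x, g i x ∂(gaussianReal 0 1) = 0) →
      |∫ y, ∏ i, g i (y i) ∂(k • (Measure.pi (fun _ : ι => gaussianReal 0 1)).withDensity
        (fun y => ENNReal.ofReal (Real.exp (∑ i, ∑ j, b i j * (y i * y j)))))| ≤
        κ ^ Fintype.card ι * a ^ 2 * √(∏ i, ∫ x, g i x ^ 2 ∂(gaussianReal 0 1)) := by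
  -- Per-coordinate constants: `α` comes from `q ≥ -|y|² / 16` and bounds the normalising factor,
  -- while `β` is the second moment of the weight `Ψ` used in Cauchy–Schwarz.
  set α : ℝ := ∫ x, Real.exp (-(1 / 16) * x ^ 2) ∂(gaussianReal 0 1) with hα
  set β : ℝ := ∫ x, Real.exp (1 / 4 * x ^ 2) ∂(gaussianReal 0 1) with hβ
  have hα0 : 0 < α := integral_exp_pos (integrable_exp_sq_div_gaussianReal (by norm_num))
  have hα1 : α ≤ 1 := by
    have : α ≤ ∫ _, (1 : ℝ) ∂(gaussianReal 0 1) := by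
      refine integral_mono (integrable_exp_sq_div_gaussianReal (by norm_num))
        (integrable_const _) fun x => ?_
      simp only [Real.exp_le_one_iff]
      nlinarith [sq_nonneg x]
    simpa using this
  have hβ1 : 1 ≤ β := by
    have : ∫ _, (1 : ℝ) ∂(gaussianReal 0 1) ≤ β := by
      refine integral_mono (integrable_const _)
        (integrable_exp_sq_div_gaussianReal (by norm_num)) fun x => ?_
      simp only [Real.one_le_exp_iff]
      positivity
    simpa using this
  have hαi : 1 ≤ α⁻¹ := (one_le_inv₀ hα0).2 hα1
  refine ⟨1024 * α⁻¹ * β, by nlinarith [mul_le_mul hαi hβ1 zero_le_one (by positivity)], ?_⟩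
  intro ι _ b a k g c ha0 ha hq hprob hg hc hcent
  set ν := Measure.pi (fun _ : ι => gaussianReal 0 1) with hν
  set q : (ι → ℝ) → ℝ := fun y => ∑ i, ∑ j, b i j * (y i * y j) with hqdef
  set G : (ι → ℝ) → ℝ := fun y => ∏ i, g i (y i) with hG
  have hqm : Measurable q := by fun_prop
  set m := Fintype.card ι with hm
  have hm3 : 3 ≤ m := hc.trans (Finset.card_le_univ c)
  have ht0 : ∀ y : ι → ℝ, 0 ≤ ∑ i, y i ^ 2 := fun y => by positivity
  -- square integrability
  set Ψ : (ι → ℝ) → ℝ := fun y => Real.exp (1 / 8 * ∑ i, y i ^ 2) with hΨ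
  have hΨm : Measurable Ψ := by fun_prop
  have hΨsq : ∀ y, Ψ y ^ 2 = Real.exp (1 / 4 * ∑ i, y i ^ 2) := fun y => by
    rw [hΨ, ← Real.exp_nat_mul]; congr 1; push_cast; ring
  have hΨ2 : MemLp Ψ 2 ν := by
    refine (memLp_two_iff_integrable_sq hΨm.aestronglyMeasurable).2 ?_
    simp_rw [hΨsq]
    exact integrable_exp_sum_sq_pi_gaussianReal ι (by norm_num)
  have hΨint : ∫ y, Ψ y ^ 2 ∂ν = β ^ m := by
    simp_rw [hΨsq]
    exact integral_exp_sum_sq_pi_gaussianReal ι _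
  have hGm : AEStronglyMeasurable G ν :=
    (Integrable.fintype_prod (μ := fun _ : ι => gaussianReal 0 1)
      fun i => (hg i).integrable one_le_two).aestronglyMeasurable
  have hGint : ∫ y, G y ^ 2 ∂ν = ∏ i, ∫ x, g i x ^ 2 ∂(gaussianReal 0 1) := by
    rw [← integral_fintype_prod_eq_prod (fun i x => g i x ^ 2)]
    simp [hG, Finset.prod_pow, hν]
  have hG2 : MemLp G 2 ν := by
    refine (memLp_two_iff_integrable_sq hGm).2 ?_
    have := Integrable.fintype_prod (μ := fun _ : ι => gaussianReal 0 1) (f := fun i x => g i x ^ 2)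
      fun i => (hg i).integrable_sq
    simpa [hG, Finset.prod_pow] using this
  -- pointwise bounds
  have htΨ : ∀ y : ι → ℝ, ∑ i, y i ^ 2 ≤ 8 * Ψ y := fun y => by
    have := Real.add_one_le_exp (1 / 8 * ∑ i, y i ^ 2)
    simp only [hΨ]; linarith
  have hyy : ∀ i j, MemLp (fun y : ι → ℝ => y i * y j) 2 ν := fun i j => by
    refine (hΨ2.const_mul 8).mono (by fun_prop) (Filter.Eventually.of_forall fun y => ?_)
    rw [Real.norm_eq_abs, Real.norm_of_nonneg (by positivity)]
    refine le_trans ?_ (htΨ y)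
    have h1 := Finset.single_le_sum (f := fun i => y i ^ 2) (fun i _ => sq_nonneg (y i))
      (Finset.mem_univ i)
    have h2 := Finset.single_le_sum (f := fun i => y i ^ 2) (fun i _ => sq_nonneg (y i))
      (Finset.mem_univ j)
    rw [abs_mul]
    nlinarith [sq_nonneg (|y i| - |y j|), sq_abs (y i), sq_abs (y j)]
  have hq16 : ∀ y, |q y| ≤ 1 / 16 * ∑ i, y i ^ 2 := fun y =>
    (hq y).trans (mul_le_mul_of_nonneg_right ha (ht0 y))
  have hexp2 : MemLp (fun y => Real.exp (q y)) 2 ν := by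
    refine hΨ2.mono (by fun_prop) (Filter.Eventually.of_forall fun y => ?_)
    rw [Real.norm_of_nonneg (by positivity), Real.norm_of_nonneg (by positivity)]
    refine Real.exp_le_exp.2 ?_
    have := (abs_le.1 (hq16 y)).2
    have := ht0 y
    linarith
  have hrem : ∀ y, |Real.exp (q y) - 1 - q y| ≤ 1024 * a ^ 2 * Ψ y := fun y => by
    set t := ∑ i, y i ^ 2 with ht
    have h1 : t ^ 2 ≤ 1024 * Real.exp (t / 16) := by
      have h2 : t ≤ 32 * Real.exp (t / 32) := by
        have := Real.add_one_le_exp (t / 32)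
        linarith
      calc t ^ 2 ≤ (32 * Real.exp (t / 32)) ^ 2 := pow_le_pow_left₀ (ht0 y) h2 2
        _ = 1024 * Real.exp (t / 16) := by
          rw [mul_pow, ← Real.exp_nat_mul]; norm_num; ring
    calc |Real.exp (q y) - 1 - q y| ≤ q y ^ 2 * Real.exp |q y| :=
          Real.abs_exp_sub_one_sub_le_sq_mul_exp _
      _ ≤ (a ^ 2 * (1024 * Real.exp (t / 16))) * Real.exp (1 / 16 * t) := by
          refine mul_le_mul ?_ (Real.exp_le_exp.2 (hq16 y)) (by positivity) (by positivity)
          calc q y ^ 2 = |q y| ^ 2 := (sq_abs _).symm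
            _ ≤ (a * t) ^ 2 := pow_le_pow_left₀ (abs_nonneg _) (hq y) 2
            _ = a ^ 2 * t ^ 2 := by ring
            _ ≤ _ := mul_le_mul_of_nonneg_left h1 (by positivity)
      _ = 1024 * a ^ 2 * Ψ y := by
          simp only [hΨ]
          rw [mul_assoc, mul_assoc, ← Real.exp_add, mul_left_comm, ← mul_assoc]
          congr 2
          ring
  -- vanishing of the terms of order zero and one
  have hG0 : ∫ y, G y ∂ν = 0 := by
    obtain ⟨i, hi⟩ := Finset.card_pos.1 (by omega : 0 < c.card)
    rw [hG, hν, integral_fintype_prod_eq_prod]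
    exact Finset.prod_eq_zero (Finset.mem_univ i) (hcent i hi)
  have hGyy : ∀ i j, ∫ y, (y i * y j) * G y ∂ν = 0 := fun i j => by
    classical
    -- Three centered coordinates are needed exactly here: one of them lies outside `{i, j}`, and
    -- its factor integrates to zero.
    obtain ⟨l, hl, hl'⟩ : ∃ l ∈ c, l ∉ ({i, j} : Finset ι) := by
      refine Finset.exists_mem_notMem_of_card_lt_card ?_
      exact (Finset.card_le_two).trans_lt (by omega)
    simp only [Finset.mem_insert, Finset.mem_singleton, not_or] at hl'
    have h1 : ∀ y : ι → ℝ, (y i * y j) * G y =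
        ∏ l, (if l = i then y l else 1) * (if l = j then y l else 1) * g l (y l) := by
      intro y
      rw [Finset.prod_mul_distrib, Finset.prod_mul_distrib]
      simp [hG]
    simp_rw [h1]
    rw [hν, integral_fintype_prod_eq_prod
      (fun l x => (if l = i then x else 1) * (if l = j then x else 1) * g l x)]
    refine Finset.prod_eq_zero (Finset.mem_univ l) ?_
    simp [hl'.1, hl'.2, hcent l hl]
  have hGyyi : ∀ i j, Integrable (fun y => b i j * ((y i * y j) * G y)) ν := fun i j =>
    ((hyy i j).integrable_mul hG2).const_mul _
  have hqG_eq : ∀ y, q y * G y = ∑ i, ∑ j, b i j * ((y i * y j) * G y) := fun y => by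
    simp only [hqdef, Finset.sum_mul, mul_assoc]
  have hqGi : Integrable (fun y => q y * G y) ν := by
    simp_rw [hqG_eq]
    exact integrable_finsetSum _ fun i _ => integrable_finsetSum _ fun j _ => hGyyi i j
  have hqG : ∫ y, q y * G y ∂ν = 0 := by
    simp_rw [hqG_eq]
    rw [integral_finsetSum _ fun i _ => integrable_finsetSum _ fun j _ => hGyyi i j]
    refine Finset.sum_eq_zero fun i _ => ?_
    rw [integral_finsetSum _ fun j _ => hGyyi i j]
    refine Finset.sum_eq_zero fun j _ => ?_
    rw [integral_const_mul, hGyy, mul_zero]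
  have hmain : |∫ y, Real.exp (q y) * G y ∂ν| ≤
      1024 * a ^ 2 * (√(β ^ m) * √(∏ i, ∫ x, g i x ^ 2 ∂(gaussianReal 0 1))) := by
    have h1 : ∫ y, Real.exp (q y) * G y ∂ν = ∫ y, (Real.exp (q y) - 1 - q y) * G y ∂ν := by
      have : ∀ y, (Real.exp (q y) - 1 - q y) * G y =
          Real.exp (q y) * G y - G y - q y * G y := fun y => by ring
      simp_rw [this]
      rw [integral_sub _ hqGi, integral_sub _ (hG2.integrable one_le_two), hG0, hqG]
      · simp
      · exact hexp2.integrable_mul hG2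
      · exact (hexp2.integrable_mul hG2).sub (hG2.integrable one_le_two)
    have hGn : MemLp (fun y => |G y|) 2 ν := hG2.norm
    have h2 := abs_integral_mul_le_sqrt_mul_sqrt hΨ2 hGn
    simp only [sq_abs] at h2
    rw [hΨint, hGint] at h2
    rw [h1]
    calc |∫ y, (Real.exp (q y) - 1 - q y) * G y ∂ν|
        ≤ ∫ y, 1024 * a ^ 2 * (Ψ y * |G y|) ∂ν := by
          rw [← Real.norm_eq_abs]
          refine norm_integral_le_of_norm_le ((hΨ2.integrable_mul hGn).const_mul _)
            (Filter.Eventually.of_forall fun y => ?_)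
          rw [norm_mul, Real.norm_eq_abs, Real.norm_eq_abs, ← mul_assoc]
          exact mul_le_mul_of_nonneg_right (hrem y) (abs_nonneg _)
      _ = 1024 * a ^ 2 * ∫ y, Ψ y * |G y| ∂ν := integral_const_mul _ _
      _ ≤ _ := mul_le_mul_of_nonneg_left ((le_abs_self _).trans h2) (by positivity)
  -- the normalising constant
  have hexpi : Integrable (fun y => Real.exp (q y)) ν := hexp2.integrable one_le_two
  have hk : k.toReal * ∫ y, Real.exp (q y) ∂ν = 1 := by
    have h1 := hprob.measure_univ
    rw [Measure.smul_apply, withDensity_apply _ MeasurableSet.univ, Measure.restrict_univ,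
      ← ofReal_integral_eq_lintegral_ofReal hexpi
        (Filter.Eventually.of_forall fun y => (Real.exp_pos _).le), smul_eq_mul] at h1
    have h2 := congrArg ENNReal.toReal h1
    rwa [ENNReal.toReal_mul, ENNReal.toReal_ofReal
      (integral_nonneg fun y => (Real.exp_pos _).le), ENNReal.toReal_one] at h2
  -- Total mass one determines `k`, so a lower bound for this integral replaces any estimate of a
  -- determinant.
  have hI : α ^ m ≤ ∫ y, Real.exp (q y) ∂ν := by
    rw [hα, hm, ← integral_exp_sum_sq_pi_gaussianReal]
    refine integral_mono (integrable_exp_sum_sq_pi_gaussianReal ι (by norm_num)) hexpi fun y => ?_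
    refine Real.exp_le_exp.2 ?_
    have := (abs_le.1 (hq16 y)).1
    linarith
  have hkle : k.toReal ≤ α⁻¹ ^ m := by
    rw [inv_pow, ← one_div, le_div_iff₀ (by positivity), ← hk]
    exact mul_le_mul_of_nonneg_left hI ENNReal.toReal_nonneg
  rw [integral_smul_measure, integral_withDensity_eq_integral_toReal_smul (by fun_prop)
    (Filter.Eventually.of_forall fun y => ENNReal.ofReal_lt_top)]
  simp only [ENNReal.toReal_ofReal (Real.exp_pos _).le, smul_eq_mul]
  rw [abs_mul, abs_of_nonneg ENNReal.toReal_nonneg]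
  set D := √(∏ i, ∫ x, g i x ^ 2 ∂(gaussianReal 0 1))
  have hβm : √(β ^ m) ≤ β ^ m := by
    rw [Real.sqrt_le_left (by positivity)]
    exact le_self_pow₀ (one_le_pow₀ hβ1) two_ne_zero
  calc k.toReal * |∫ y, Real.exp (q y) * G y ∂ν|
      ≤ α⁻¹ ^ m * (1024 ^ m * a ^ 2 * (β ^ m * D)) := by
        refine mul_le_mul hkle (hmain.trans ?_) (abs_nonneg _) (by positivity)
        have : (1024 : ℝ) ≤ 1024 ^ m := le_self_pow₀ (by norm_num) (by omega)
        gcongr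
    _ = _ := by rw [mul_pow, mul_pow]; ring

/-! ### Transfer to correlated Gaussian vectors -/

-- With `T` the square root of `S`, near-identity of `S = Tᵀ T` makes `T` invertible, and the change
-- of variables exhibits the law as `exp` of the quadratic form `(|y|² - |T⁻¹ y|²) / 2`, up to a
-- constant.
open scoped MatrixOrder in
theorem exists_abs_integral_prod_multivariateGaussian_le :
    ∃ κ : ℝ, 1 ≤ κ ∧ ∀ (ι : Type) [Fintype ι] [DecidableEq ι] (S : Matrix ι ι ℝ) (a : ℝ)
      (g : ι → ℝ → ℝ) (c : Finset ι), S.PosSemidef → 0 ≤ a → a ≤ 1 / 16 →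
      ∑ i, ∑ j, (S - 1) i j ^ 2 ≤ a ^ 2 →
      (∀ i, MemLp (g i) 2 (gaussianReal 0 1)) → 3 ≤ c.card →
      (∀ i ∈ c, ∫ x, g i x ∂(gaussianReal 0 1) = 0) →
      |∫ y, ∏ i, g i (y i) ∂((multivariateGaussian 0 S).map WithLp.ofLp)| ≤
        κ ^ Fintype.card ι * a ^ 2 * √(∏ i, ∫ x, g i x ^ 2 ∂(gaussianReal 0 1)) := by
  obtain ⟨κ, hκ, H⟩ := exists_abs_integral_prod_le_of_exp_quadratic
  refine ⟨κ, hκ, fun ι _ _ S a g c hS ha0 ha hSa hg hc hcent => ?_⟩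
  set T := CFC.sqrt S with hT
  have hTa : ∑ i, ∑ j, (T.transpose * T - 1) i j ^ 2 ≤ a ^ 2 := by
    rwa [hT, Matrix.transpose_sqrt_mul_sqrt hS]
  have hdet := det_ne_zero_of_near_isometry ha0 (by linarith) hTa
  have hq : ∀ y : ι → ℝ, (∑ i, y i ^ 2 - ∑ i, T⁻¹.mulVec y i ^ 2) / 2 =
      ∑ i, ∑ j, (1 - T⁻¹.transpose * T⁻¹) i j / 2 * (y i * y j) := by
    intro y
    have e1 : ∑ i, T⁻¹.mulVec y i ^ 2 = y ⬝ᵥ (T⁻¹.transpose * T⁻¹).mulVec y := by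
      rw [← Matrix.mulVec_mulVec, Matrix.dotProduct_mulVec, Matrix.vecMul_transpose]
      simp [dotProduct, sq]
    have e2 : ∑ i, y i ^ 2 = y ⬝ᵥ (1 : Matrix ι ι ℝ).mulVec y := by
      simp [dotProduct, sq]
    rw [e1, e2, ← dotProduct_sub, ← Matrix.sub_mulVec]
    simp only [dotProduct, Matrix.mulVec, Finset.mul_sum, Finset.sum_div]
    refine Finset.sum_congr rfl fun i _ => Finset.sum_congr rfl fun j _ => by ring
  have hmap := pi_gaussianReal_map_mulVec T hdet
  simp_rw [hq] at hmap
  have hmap' := (multivariateGaussian_zero_map_ofLp S).trans hmap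
  rw [hmap']
  refine H ι _ a _ g c ha0 ha (fun y => ?_) ?_ hg hc hcent
  · rw [← hq, abs_div, abs_two, div_le_iff₀ two_pos]
    refine (abs_sum_sq_sub_inv_mulVec_le ha0 (by linarith) hTa y).trans (le_of_eq ?_)
    ring
  · rw [← hmap']
    exact Measure.isProbabilityMeasure_map (by fun_prop)

/-- The image of a centered Gaussian vector under a matrix. -/
theorem multivariateGaussian_zero_map_transpose {ι κ : Type*} [Fintype ι] [DecidableEq ι]
    [Fintype κ] [DecidableEq κ] {S : Matrix ι ι ℝ} (hS : S.PosSemidef) (B : Matrix ι κ ℝ) :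
    (multivariateGaussian 0 S).map (fun x => WithLp.toLp 2 (B.transpose.mulVec x.ofLp)) =
      multivariateGaussian 0 (B.transpose * S * B) := by
  have hm : Measurable (fun x : EuclideanSpace ℝ ι => WithLp.toLp 2 (B.transpose.mulVec x.ofLp)) := by
    have : Measurable B.transpose.mulVec :=
      (Continuous.matrix_mulVec continuous_const continuous_id).measurable
    fun_prop
  have hS' : (B.transpose * S * B).PosSemidef := by
    simpa [Matrix.conjTranspose_eq_transpose_of_trivial] using hS.conjTranspose_mul_mul_same B
  have : IsProbabilityMeasure ((multivariateGaussian 0 S).map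
      (fun x => WithLp.toLp 2 (B.transpose.mulVec x.ofLp))) :=
    Measure.isProbabilityMeasure_map hm.aemeasurable
  apply Measure.ext_of_charFun
  ext t
  have hin : ∀ x : EuclideanSpace ℝ ι, inner ℝ (WithLp.toLp 2 (B.transpose.mulVec x.ofLp)) t =
      inner ℝ x (WithLp.toLp 2 (B.mulVec t.ofLp)) := by
    intro x
    simp only [PiLp.inner_apply, RCLike.inner_apply, conj_trivial]
    change t.ofLp ⬝ᵥ _ = B.mulVec t.ofLp ⬝ᵥ x.ofLp
    rw [Matrix.mulVec_transpose, dotProduct_comm, ← Matrix.dotProduct_mulVec, dotProduct_comm]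
  rw [charFun_apply, integral_map hm.aemeasurable (by fun_prop)]
  simp_rw [hin]
  rw [← charFun_apply, charFun_multivariateGaussian hS, charFun_multivariateGaussian hS']
  simp only [inner_zero_right]
  rw [← Matrix.mulVec_mulVec, ← Matrix.mulVec_mulVec, Matrix.dotProduct_mulVec _ B.transpose,
    Matrix.vecMul_transpose]

/-- Squared correlation of two distinct coordinates of a Gaussian vector with covariance `Cov`;
zero on the diagonal. -/
noncomputable def offDiagCorrSq {ι : Type*} [DecidableEq ι] (Cov : Matrix ι ι ℝ) (i j : ι) : ℝ :=
  if i = j then 0 else Cov i j ^ 2 / (Cov i i * Cov j j)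

theorem offDiagCorrSq_nonneg {ι : Type*} [DecidableEq ι] {Cov : Matrix ι ι ℝ}
    (hCov : Cov.PosSemidef) (i j : ι) : 0 ≤ offDiagCorrSq Cov i j := by
  unfold offDiagCorrSq
  split_ifs
  · exact le_rfl
  · exact div_nonneg (sq_nonneg _) (mul_nonneg hCov.diag_nonneg hCov.diag_nonneg)

theorem hasLaw_eval_div_sqrt {ι : Type*} [Fintype ι] [DecidableEq ι] {Cov : Matrix ι ι ℝ}
    (hCov : Cov.PosSemidef) (hdiag : ∀ i, Cov i i ≠ 0) {Ω : Type*} {mΩ : MeasurableSpace Ω}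
    {P : Measure Ω} {z : Ω → EuclideanSpace ℝ ι} (hz : HasLaw z (multivariateGaussian 0 Cov) P)
    (i : ι) : HasLaw (fun ω => z ω i / √(Cov i i)) (gaussianReal 0 1) P := by
  have hpos : 0 < Cov i i := lt_of_le_of_ne hCov.diag_nonneg (hdiag i).symm
  have h1 := (measurePreserving_eval_multivariateGaussian (μ := 0) hCov (i := i)).fun_comp_hasLaw hz
  have h2 := gaussianReal_div_const h1 (√(Cov i i))
  convert h2 using 2
  · simp
  · ext
    simp [Real.sq_sqrt hpos.le, hpos.le, hpos.ne']

/-- Only the block indexed by `s` has to be close to the identity; the full covariance may be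
singular. After rescaling, that block is a correlation matrix, with unit diagonal and off-diagonal
squares `offDiagCorrSq`. -/
theorem exists_abs_integral_prod_normalized_le :
    ∃ κ : ℝ, 1 ≤ κ ∧ ∀ (ι : Type) [Fintype ι] [DecidableEq ι] (Cov : Matrix ι ι ℝ),
      Cov.PosSemidef → (∀ i, Cov i i ≠ 0) →
      ∀ {Ω : Type*} {_ : MeasurableSpace Ω} {P : Measure Ω} {z : Ω → EuclideanSpace ℝ ι},
      HasLaw z (multivariateGaussian 0 Cov) P →
      ∀ (s : Finset ι) (a : ℝ) (g : ι → ℝ → ℝ) (c : Finset ι), 0 ≤ a → a ≤ 1 / 16 →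
      ∑ i ∈ s, ∑ j ∈ s, offDiagCorrSq Cov i j ≤ a ^ 2 →
      (∀ i ∈ s, MemLp (g i) 2 (gaussianReal 0 1)) → c ⊆ s → 3 ≤ c.card →
      (∀ i ∈ c, ∫ x, g i x ∂(gaussianReal 0 1) = 0) →
      |∫ ω, ∏ i ∈ s, g i (z ω i / √(Cov i i)) ∂P| ≤
        κ ^ s.card * a ^ 2 * √(∏ i ∈ s, ∫ x, g i x ^ 2 ∂(gaussianReal 0 1)) := by
  obtain ⟨κ, hκ, H⟩ := exists_abs_integral_prod_multivariateGaussian_le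
  refine ⟨κ, hκ, fun ι _ _ Cov hCov hdiag Ω mΩ P z hz s a g c ha0 ha hsa hg hcs hc hcent => ?_⟩
  have hpos : ∀ i, 0 < Cov i i := fun i => lt_of_le_of_ne hCov.diag_nonneg (hdiag i).symm
  -- `Bᵀ` selects the coordinates in `s` and divides each by its standard deviation.
  set B : Matrix ι s ℝ := Matrix.of fun k j => if k = j then (√(Cov j j))⁻¹ else 0 with hB
  set S : Matrix s s ℝ := B.transpose * Cov * B with hS
  have hSps : S.PosSemidef := by
    simpa [Matrix.conjTranspose_eq_transpose_of_trivial] using hCov.conjTranspose_mul_mul_same B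
  have hSij : ∀ i j : s, S i j = Cov i j / (√(Cov i i) * √(Cov j j)) := by
    intro i j
    simp only [hS, hB, Matrix.mul_apply, Matrix.transpose_apply, Matrix.of_apply, ite_mul, zero_mul,
      mul_ite, mul_zero, Finset.sum_ite_eq', Finset.mem_univ, if_true]
    rw [div_eq_mul_inv, mul_inv]
    ring
  have hSii : ∀ i : s, S i i = 1 := fun i => by
    rw [hSij, Real.mul_self_sqrt (hpos i).le, div_self (hdiag i)]
  have hBz : ∀ x : EuclideanSpace ℝ ι,
      B.transpose.mulVec x.ofLp = fun j : s => x j / √(Cov j j) := by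
    intro x
    ext j
    simp [hB, Matrix.mulVec, dotProduct, div_eq_mul_inv, mul_comm]
  have hlaw : HasLaw (fun ω (j : s) => z ω j / √(Cov j j))
      ((multivariateGaussian 0 S).map WithLp.ofLp) P := by
    refine ⟨?_, ?_⟩
    · have := hz.aemeasurable
      fun_prop
    · rw [hS, ← multivariateGaussian_zero_map_transpose hCov B, ← hz.map_eq]
      simp_rw [hBz]
      rw [AEMeasurable.map_map_of_aemeasurable (by fun_prop) hz.aemeasurable,
        AEMeasurable.map_map_of_aemeasurable (by fun_prop)
          (AEMeasurable.comp_aemeasurable (by fun_prop) hz.aemeasurable)]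
      rfl
  have heval : ∀ j : s, MeasurePreserving (fun y : s → ℝ => y j)
      ((multivariateGaussian 0 S).map WithLp.ofLp) (gaussianReal 0 1) := fun j => by
    refine ⟨by fun_prop, ?_⟩
    rw [Measure.map_map (by fun_prop) (by fun_prop)]
    have := (measurePreserving_eval_multivariateGaussian (μ := 0) hSps (i := j)).map_eq
    rw [hSii] at this
    simpa [Function.comp_def] using this
  have hmeas : AEStronglyMeasurable (fun y : s → ℝ => ∏ j : s, g j (y j))
      ((multivariateGaussian 0 S).map WithLp.ofLp) :=
    Finset.aestronglyMeasurable_fun_prod _ fun j _ =>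
      (hg j j.2).aestronglyMeasurable.comp_measurePreserving (heval j)
  have key := H s S a (fun j => g j) (c.subtype (· ∈ s)) hSps ha0 ha ?_ (fun j => hg j j.2) ?_ ?_
  · rw [← hlaw.integral_comp hmeas] at key
    rw [Fintype.card_coe] at key
    rw [← Finset.prod_coe_sort s]
    refine le_trans (le_of_eq ?_) key
    congr 2
    ext ω
    simp only [Function.comp_apply]
    exact (Finset.prod_coe_sort s _).symm
  · refine le_trans (le_of_eq ?_) hsa
    rw [← Finset.sum_coe_sort s]
    refine Finset.sum_congr rfl fun i _ => ?_
    rw [← Finset.sum_coe_sort s]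
    refine Finset.sum_congr rfl fun j _ => ?_
    unfold offDiagCorrSq
    by_cases h : i = j
    · subst h
      simp [hSii]
    · rw [if_neg (fun h' => h (Subtype.ext h')), Matrix.sub_apply, Matrix.one_apply_ne h, sub_zero,
        hSij, div_pow, mul_pow, Real.sq_sqrt (hpos i).le, Real.sq_sqrt (hpos j).le]
  · rw [Finset.card_subtype, Finset.filter_true_of_mem hcs]
    exact hc
  · intro i hi
    exact hcent i (Finset.mem_subtype.1 hi)

/-! ### Mixed moments over index tuples -/

theorem abs_prod_le_sum_pow {ι : Type*} (s : Finset ι) (hs : s.Nonempty) (x : ι → ℝ) :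
    |∏ a ∈ s, x a| ≤ ∑ a ∈ s, |x a| ^ s.card := by
  obtain ⟨m, hm, hmax⟩ := Finset.exists_max_image s (fun a => |x a|) hs
  rw [Finset.abs_prod]
  calc ∏ a ∈ s, |x a| ≤ ∏ _a ∈ s, |x m| :=
        Finset.prod_le_prod (fun _ _ => abs_nonneg _) fun a ha => hmax a ha
    _ = |x m| ^ s.card := by rw [Finset.prod_const]
    _ ≤ _ := Finset.single_le_sum (f := fun a => |x a| ^ s.card) (fun _ _ => by positivity) hm

/-- A map from a set of `N` elements whose image has at least `N - 1` elements has fibers of size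
at most two, and at least `N - 2` singleton fibers. -/
theorem card_fiber_of_le_card_image {α β : Type*} [Fintype α] [DecidableEq β] (t : α → β)
    (h : Fintype.card α ≤ (Finset.univ.image t).card + 1) :
    (∀ j ∈ Finset.univ.image t, (Finset.univ.filter fun a => t a = j).card ∈ Set.Icc 1 2) ∧
    Fintype.card α ≤ ((Finset.univ.image t).filter
      fun j => (Finset.univ.filter fun a => t a = j).card = 1).card + 2 := by
  set s := Finset.univ.image t with hs
  set m : β → ℕ := fun j => (Finset.univ.filter fun a => t a = j).card with hm
  have hm1 : ∀ j ∈ s, 1 ≤ m j := by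
    intro j hj
    obtain ⟨a, -, ha⟩ := Finset.mem_image.1 hj
    exact Finset.card_pos.2 ⟨a, by simp [ha]⟩
  have hsum : ∑ j ∈ s, m j = Fintype.card α := by
    rw [← Finset.card_univ]
    exact (Finset.card_eq_sum_card_image t Finset.univ).symm
  -- The total excess of the fiber sizes over one is the defect of the image, so at most one fiber
  -- is not a singleton, and it has two elements.
  have hsum1 : ∑ j ∈ s, (m j - 1) ≤ 1 := by
    have h1 : ∑ j ∈ s, (m j - 1) + ∑ _j ∈ s, 1 = ∑ j ∈ s, m j := by
      rw [← Finset.sum_add_distrib]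
      exact Finset.sum_congr rfl fun j hj => Nat.sub_add_cancel (hm1 j hj)
    rw [Finset.sum_const, smul_eq_mul, mul_one] at h1
    omega
  refine ⟨fun j hj => ⟨hm1 j hj, ?_⟩, ?_⟩
  · have := (Finset.single_le_sum (f := fun j => m j - 1) (fun _ _ => Nat.zero_le _) hj).trans hsum1
    change m j ≤ 2
    omega
  · have h2 : (s.filter fun j => ¬ m j = 1).card ≤ 1 := by
      refine le_trans ?_ hsum1
      rw [Finset.card_eq_sum_ones]
      refine (Finset.sum_le_sum fun j hj => ?_).trans
        (Finset.sum_le_sum_of_subset (Finset.filter_subset (fun j => ¬ m j = 1) s))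
      obtain ⟨hj1, hj2⟩ := Finset.mem_filter.1 hj
      have := hm1 j hj1
      omega
    have h3 := Finset.card_filter_add_card_filter_not (s := s) (fun j => m j = 1)
    change _ ≤ (s.filter fun j => m j = 1).card + 2
    omega

theorem sum_image_le_sum_comp {α β : Type*} [Fintype α] [DecidableEq β] (t : α → β) {h : β → ℝ}
    (hh : ∀ j, 0 ≤ h j) : ∑ j ∈ Finset.univ.image t, h j ≤ ∑ a, h (t a) := by
  rw [Finset.sum_comp h t]
  refine Finset.sum_le_sum fun j hj => ?_
  obtain ⟨a, -, ha⟩ := Finset.mem_image.1 hj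
  have h1 : 1 ≤ (Finset.univ.filter fun a => t a = j).card := Finset.card_pos.2 ⟨a, by simp [ha]⟩
  rw [nsmul_eq_mul]
  exact le_mul_of_one_le_left (hh j) (by exact_mod_cast h1)

theorem pow_two_mul_le_one_add {x : ℝ} {m p : ℕ} (h : m ≤ p) :
    x ^ (2 * m) ≤ 1 + x ^ (2 * p) := by
  rw [pow_mul, pow_mul]
  rcases le_total (x ^ 2) 1 with h1 | h1
  · exact (pow_le_one₀ (sq_nonneg x) h1).trans (le_add_of_nonneg_right (by positivity))
  · exact (pow_le_pow_right₀ h1 h).trans (le_add_of_nonneg_left zero_le_one)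

/-- Makes a repeated factor `f ^ m` admissible in the Gaussian estimate, which asks for square
integrability. -/
theorem memLp_two_pow_of_integrable_pow {α : Type*} {mα : MeasurableSpace α} {μ : Measure α}
    [IsProbabilityMeasure μ] {f : α → ℝ} (hf : AEStronglyMeasurable f μ) {m p : ℕ} (h : m ≤ p)
    (hint : Integrable (fun x => f x ^ (2 * p)) μ) :
    MemLp (fun x => f x ^ m) 2 μ ∧ ∫ x, (f x ^ m) ^ 2 ∂μ ≤ 1 + ∫ x, f x ^ (2 * p) ∂μ := by
  have hb : ∀ x, (f x ^ m) ^ 2 ≤ 1 + f x ^ (2 * p) := fun x => by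
    rw [← pow_mul, mul_comm m 2]
    exact pow_two_mul_le_one_add h
  have hi : Integrable (fun x => (f x ^ m) ^ 2) μ := by
    refine ((integrable_const 1).add hint).mono' ((hf.pow m).pow 2)
      (Filter.Eventually.of_forall fun x => ?_)
    rw [Real.norm_of_nonneg (sq_nonneg _)]
    exact hb x
  refine ⟨(memLp_two_iff_integrable_sq (hf.pow m)).2 hi, ?_⟩
  refine (integral_mono hi ((integrable_const 1).add hint) hb).trans (le_of_eq ?_)
  simp [integral_add (integrable_const (1 : ℝ)) hint]

/-- The trivial bound: a product of `2p` factors is at most the `2p`-th power of the largest. It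
serves where no cancellation is available. -/
theorem integrable_prod_of_integrable_pow {α β : Type*} {mα : MeasurableSpace α} {μ : Measure α}
    {p : ℕ} (hp : 1 ≤ p) {Y : β → α → ℝ} (hY : ∀ i, AEStronglyMeasurable (Y i) μ)
    (hint : ∀ i, Integrable (fun ω => Y i ω ^ (2 * p)) μ) (t : Fin (2 * p) → β) :
    Integrable (fun ω => ∏ a, Y (t a) ω) μ ∧
      |∫ ω, ∏ a, Y (t a) ω ∂μ| ≤ ∑ a, ∫ ω, Y (t a) ω ^ (2 * p) ∂μ := by
  have hb : ∀ ω, ‖∏ a, Y (t a) ω‖ ≤ ∑ a, Y (t a) ω ^ (2 * p) := fun ω => by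
    have : NeZero (2 * p) := ⟨by omega⟩
    have h1 := abs_prod_le_sum_pow Finset.univ Finset.univ_nonempty fun a => Y (t a) ω
    simpa only [Real.norm_eq_abs, Finset.card_univ, Fintype.card_fin, (even_two_mul p).pow_abs] using h1
  have hi : Integrable (fun ω => ∑ a, Y (t a) ω ^ (2 * p)) μ :=
    integrable_finsetSum _ fun a _ => hint (t a)
  refine ⟨hi.mono' (Finset.aestronglyMeasurable_fun_prod _ fun a _ => hY (t a))
    (Filter.Eventually.of_forall hb), ?_⟩
  rw [← Real.norm_eq_abs]
  refine (norm_integral_le_of_norm_le hi (Filter.Eventually.of_forall hb)).trans (le_of_eq ?_)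
  exact integral_finsetSum _ fun a _ => hint (t a)

/-- Mixed moments of normalized functions of the coordinates of a Gaussian vector, over index
tuples with at most one repetition, are controlled by the squared correlations. -/
theorem exists_abs_integral_prod_tuple_le (p : ℕ) (hp : 3 ≤ p) :
    ∃ C : ℝ, 0 ≤ C ∧ ∀ (ι : Type) [Fintype ι] [DecidableEq ι] (Cov : Matrix ι ι ℝ),
      Cov.PosSemidef → (∀ i, Cov i i ≠ 0) →
      ∀ {Ω : Type*} {_ : MeasurableSpace Ω} {P : Measure Ω} {z : Ω → EuclideanSpace ℝ ι},
      HasLaw z (multivariateGaussian 0 Cov) P →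
      ∀ f : ι → ℝ → ℝ, (∀ i, AEStronglyMeasurable (f i) (gaussianReal 0 1)) →
      (∀ i, ∫ x, f i x ∂(gaussianReal 0 1) = 0) →
      (∀ i, Integrable (fun x => f i x ^ (2 * p)) (gaussianReal 0 1)) →
      (∀ i, ∫ x, f i x ^ (2 * p) ∂(gaussianReal 0 1) ≤ 1) →
      ∀ t : Fin (2 * p) → ι, 2 * p ≤ (Finset.univ.image t).card + 1 →
      |∫ ω, ∏ a, f (t a) (z ω (t a) / √(Cov (t a) (t a))) ∂P| ≤
        C * ∑ a, ∑ b, offDiagCorrSq Cov (t a) (t b) := by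
  obtain ⟨κ, hκ, H⟩ := exists_abs_integral_prod_normalized_le
  -- The first entry serves `W ≥ 1 / 256`, where the trivial bound `2p` is at most `256 * (2 * p) *
  -- W`. The second serves `W ≤ 1 / 256`, where `a = √W ≤ 1 / 16` is allowed in the perturbative
  -- estimate and each factor has second moment at most 2.
  refine ⟨max (256 * (2 * p)) (κ ^ (2 * p) * 2 ^ (2 * p)), le_max_of_le_left (by positivity),
    fun ι _ _ Cov hCov hdiag Ω mΩ P z hz f hf hf0 hfi hf1 t ht => ?_⟩
  set W := ∑ a, ∑ b, offDiagCorrSq Cov (t a) (t b) with hW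
  have hr := offDiagCorrSq_nonneg hCov
  have hW0 : 0 ≤ W := Finset.sum_nonneg fun a _ => Finset.sum_nonneg fun b _ => hr _ _
  have hlaw := hasLaw_eval_div_sqrt hCov hdiag hz
  rcases le_total (1 / 256) W with hbig | hsmall
  · have hY : ∀ i, AEStronglyMeasurable (fun ω => f i (z ω i / √(Cov i i))) P := fun i =>
      AEStronglyMeasurable.comp_aemeasurable ((hlaw i).map_eq ▸ hf i) (hlaw i).aemeasurable
    have hpow : ∀ i, AEStronglyMeasurable (fun x => f i x ^ (2 * p)) (gaussianReal 0 1) :=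
      fun i => (hf i).pow _
    have hint : ∀ i, Integrable (fun ω => f i (z ω i / √(Cov i i)) ^ (2 * p)) P := fun i =>
      Integrable.comp_aemeasurable (g := fun x => f i x ^ (2 * p)) ((hlaw i).map_eq ▸ hfi i)
        (hlaw i).aemeasurable
    have h1 := (integrable_prod_of_integrable_pow (by omega) hY hint t).2
    have h2 : ∀ i, ∫ ω, f i (z ω i / √(Cov i i)) ^ (2 * p) ∂P ≤ 1 := fun i =>
      ((hlaw i).integral_comp (hpow i)).trans_le (hf1 i)
    calc _ ≤ _ := h1
      _ ≤ ∑ _a : Fin (2 * p), (1 : ℝ) := Finset.sum_le_sum fun a _ => h2 (t a)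
      _ = 256 * (2 * p) * (1 / 256) := by simp; ring
      _ ≤ _ := mul_le_mul (le_max_left _ _) hbig (by norm_num)
          (le_max_of_le_left (by positivity))
  · obtain ⟨hfib, hsing⟩ := card_fiber_of_le_card_image t (by simpa using ht)
    rw [Fintype.card_fin] at hsing
    set s := Finset.univ.image t with hs
    set m : ι → ℕ := fun j => (Finset.univ.filter fun a => t a = j).card with hm
    have hsing' : 3 ≤ (s.filter fun j => m j = 1).card := by
      change 2 * p ≤ (s.filter fun j => m j = 1).card + 2 at hsing
      omega
    have hprod : ∀ ω, ∏ a, f (t a) (z ω (t a) / √(Cov (t a) (t a))) =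
        ∏ j ∈ s, (fun j x => f j x ^ m j) j (z ω j / √(Cov j j)) := fun ω =>
      Finset.prod_comp (fun j => f j (z ω j / √(Cov j j))) t
    simp_rw [hprod]
    have hmem : ∀ j ∈ s, MemLp (fun x => f j x ^ m j) 2 (gaussianReal 0 1) ∧
        ∫ x, (f j x ^ m j) ^ 2 ∂(gaussianReal 0 1) ≤ 2 := fun j hj => by
      have h1 := memLp_two_pow_of_integrable_pow (hf j)
        (show m j ≤ p from (hfib j hj).2.trans (by omega)) (hfi j)
      exact ⟨h1.1, h1.2.trans (by linarith [hf1 j])⟩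
    have hcard : s.card ≤ 2 * p := by
      simpa using Finset.card_image_le (s := Finset.univ) (f := t)
    have hsW : ∑ i ∈ s, ∑ j ∈ s, offDiagCorrSq Cov i j ≤ √W ^ 2 := by
      rw [Real.sq_sqrt hW0]
      refine (sum_image_le_sum_comp t fun i => Finset.sum_nonneg fun j _ => hr i j).trans ?_
      exact Finset.sum_le_sum fun a _ => sum_image_le_sum_comp t fun j => hr _ j
    have hsqrt : √W ≤ 1 / 16 := Real.sqrt_le_iff.2 ⟨by norm_num, by norm_num; linarith⟩
    have key := H ι Cov hCov hdiag hz s (√W) (fun j x => f j x ^ m j)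
      (s.filter fun j => m j = 1) (Real.sqrt_nonneg _) hsqrt hsW (fun j hj => (hmem j hj).1)
      (Finset.filter_subset _ _) hsing'
      (fun j hj => by simp only [(Finset.mem_filter.1 hj).2, pow_one, hf0])
    refine key.trans ?_
    rw [Real.sq_sqrt hW0]
    have hD : √(∏ j ∈ s, ∫ x, (f j x ^ m j) ^ 2 ∂(gaussianReal 0 1)) ≤ 2 ^ (2 * p) := by
      refine Real.sqrt_le_iff.2 ⟨by positivity, ?_⟩
      calc ∏ j ∈ s, ∫ x, (f j x ^ m j) ^ 2 ∂(gaussianReal 0 1) ≤ ∏ _j ∈ s, (2 : ℝ) :=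
            Finset.prod_le_prod (fun j _ => integral_nonneg fun x => sq_nonneg _)
              fun j hj => (hmem j hj).2
        _ = 2 ^ s.card := by rw [Finset.prod_const]
        _ ≤ 2 ^ (2 * p) := pow_le_pow_right₀ one_le_two hcard
        _ ≤ (2 ^ (2 * p)) ^ 2 := le_self_pow₀ (one_le_pow₀ one_le_two) two_ne_zero
    calc κ ^ s.card * W * √(∏ j ∈ s, ∫ x, (f j x ^ m j) ^ 2 ∂(gaussianReal 0 1))
        ≤ κ ^ (2 * p) * W * 2 ^ (2 * p) := by
          have := pow_le_pow_right₀ hκ hcard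
          have hκ0 : 0 ≤ κ := by linarith
          gcongr
      _ = κ ^ (2 * p) * 2 ^ (2 * p) * W := by ring
      _ ≤ _ := mul_le_mul_of_nonneg_right (le_max_right _ _) hW0

/-! ### Counting tuples and summing the moments -/

/-- There are few maps whose image misses the maximal size by at least two. -/
theorem card_filter_card_image_add_two_le (N : ℕ) (ι : Type*) [Fintype ι] [DecidableEq ι] :
    ((Finset.univ : Finset (Fin N → ι)).filter
      fun t => (Finset.univ.image t).card + 2 ≤ N).card ≤ N ^ N * Fintype.card ι ^ (N - 2) := by
  -- Tuples are classified by a map `g` sending each position to a chosen representative of its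
  -- fiber. For fixed `g` the tuple is determined by its values on the image of `g`, which has at
  -- most `N - 2` elements.
  set F : (Fin N → Fin N) → Finset (Fin N → ι) := fun g =>
    Finset.univ.filter fun t => (Finset.univ.image t).card + 2 ≤ N ∧ t ∘ g = t ∧
      (Finset.univ.image g).card = (Finset.univ.image t).card with hF
  have hsub : ((Finset.univ : Finset (Fin N → ι)).filter
      fun t => (Finset.univ.image t).card + 2 ≤ N) ⊆ Finset.univ.biUnion F := by
    intro t ht
    have htN := (Finset.mem_filter.1 ht).2
    have : Nonempty (Fin N) := ⟨⟨0, by omega⟩⟩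
    set g : Fin N → Fin N := fun a => Function.invFun t (t a) with hg
    have htg : t ∘ g = t := funext fun a => Function.invFun_eq ⟨a, rfl⟩
    refine Finset.mem_biUnion.2 ⟨g, Finset.mem_univ _, Finset.mem_filter.2
      ⟨Finset.mem_univ _, htN, htg, ?_⟩⟩
    have h1 : Finset.univ.image g = (Finset.univ.image t).image (Function.invFun t) := by
      rw [Finset.image_image]; rfl
    apply le_antisymm
    · rw [h1]; exact Finset.card_image_le
    · have h2 : Finset.univ.image t = (Finset.univ.image g).image t := by
        rw [Finset.image_image, htg]
      rw [h2]; exact Finset.card_image_le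
  refine (Finset.card_le_card hsub).trans (Finset.card_biUnion_le.trans ?_)
  have hcard : ∀ g ∈ (Finset.univ : Finset (Fin N → Fin N)),
      (F g).card ≤ Fintype.card ι ^ (N - 2) := by
    intro g _
    rcases (F g).eq_empty_or_nonempty with h0 | ⟨t₀, ht₀⟩
    · simp [h0]
    obtain ⟨-, h1, -, h2⟩ := Finset.mem_filter.1 ht₀
    have hle : (F g).card ≤ (Finset.univ : Finset (Finset.univ.image g → ι)).card := by
      refine Finset.card_le_card_of_injOn (fun t b => t b) (fun _ _ => Finset.mem_coe.2
        (Finset.mem_univ _)) ?_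
      intro t ht t' ht' heq
      have e1 := (Finset.mem_filter.1 (Finset.mem_coe.1 ht)).2.2.1
      have e2 := (Finset.mem_filter.1 (Finset.mem_coe.1 ht')).2.2.1
      rw [← e1, ← e2]
      funext a
      exact congrFun heq ⟨g a, Finset.mem_image_of_mem g (Finset.mem_univ a)⟩
    refine hle.trans ?_
    rw [Finset.card_univ, Fintype.card_fun, Fintype.card_coe]
    refine Nat.pow_le_pow_right (Fintype.card_pos_iff.2 ⟨t₀ ⟨0, by omega⟩⟩) (by omega)
  refine (Finset.sum_le_card_nsmul _ _ _ hcard).trans (le_of_eq ?_)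
  simp

/-- Prescribing the values at two distinct positions leaves `N - 2` free ones. -/
theorem sum_tuple_eval_two {N : ℕ} {ι : Type*} [Fintype ι] [DecidableEq ι] (h : ι → ι → ℝ)
    {a b : Fin N} (hab : a ≠ b) :
    ∑ t : Fin N → ι, h (t a) (t b) = (Fintype.card ι : ℝ) ^ (N - 2) * ∑ i, ∑ j, h i j := by
  have hcount : ∀ i j, ((Finset.univ : Finset (Fin N → ι)).filter
      fun t => t a = i ∧ t b = j).card = Fintype.card ι ^ (N - 2) := by
    intro i j
    have h1 : ((Finset.univ : Finset (Fin N → ι)).filter fun t => t a = i ∧ t b = j) =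
        Fintype.piFinset fun c => if c = a then {i} else if c = b then {j} else Finset.univ := by
      ext t
      simp only [Finset.mem_filter, Finset.mem_univ, true_and, Fintype.mem_piFinset]
      constructor
      · rintro ⟨h1, h2⟩ c
        split_ifs with hca hcb
        · simp [hca, h1]
        · simp [hcb, h2]
        · simp
      · intro H
        refine ⟨by simpa using H a, by simpa [hab.symm] using H b⟩
    rw [h1, Fintype.card_piFinset]
    have h2 : ∀ c, (if c = a then {i} else if c = b then {j} else
        (Finset.univ : Finset ι)).card = if c ∈ ({a, b} : Finset (Fin N)) then 1
          else Fintype.card ι := by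
      intro c
      by_cases hca : c = a <;> by_cases hcb : c = b <;>
        simp [hca, hcb, hab.symm]
    simp_rw [h2]
    rw [Finset.prod_ite, Finset.prod_const_one, one_mul, Finset.prod_const]
    congr 1
    have h3 : (Finset.univ.filter fun c => c ∉ ({a, b} : Finset (Fin N))) = ({a, b} : Finset _)ᶜ := by
      ext c; simp
    rw [h3, Finset.card_compl, Fintype.card_fin, Finset.card_pair hab]
  have h4 : ∀ t : Fin N → ι, h (t a) (t b) =
      ∑ i, ∑ j, if t a = i ∧ t b = j then h i j else 0 := by
    intro t
    rw [Finset.sum_eq_single (t a) (fun i _ hi => Finset.sum_eq_zero fun j _ =>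
      if_neg fun h' => hi h'.1.symm) (by simp)]
    simp
  simp_rw [h4]
  rw [Finset.sum_comm, Finset.mul_sum]
  refine Finset.sum_congr rfl fun i _ => ?_
  rw [Finset.sum_comm, Finset.mul_sum]
  refine Finset.sum_congr rfl fun j _ => ?_
  rw [← Finset.sum_filter, Finset.sum_const, hcount, nsmul_eq_mul]
  push_cast
  ring

/-- Moment bound for a sum of normalized centered functions of the coordinates of a weakly
correlated Gaussian vector. -/
theorem exists_integral_sum_pow_le (p : ℕ) (hp : 3 ≤ p) :
    ∃ C : ℝ, 0 ≤ C ∧ ∀ (ι : Type) [Fintype ι] [DecidableEq ι] (Cov : Matrix ι ι ℝ),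
      Cov.PosSemidef → (∀ i, Cov i i ≠ 0) →
      ∀ {Ω : Type*} {_ : MeasurableSpace Ω} {P : Measure Ω} {z : Ω → EuclideanSpace ℝ ι},
      HasLaw z (multivariateGaussian 0 Cov) P →
      ∀ f : ι → ℝ → ℝ, (∀ i, AEStronglyMeasurable (f i) (gaussianReal 0 1)) →
      (∀ i, ∫ x, f i x ∂(gaussianReal 0 1) = 0) →
      (∀ i, Integrable (fun x => f i x ^ (2 * p)) (gaussianReal 0 1)) →
      (∀ i, ∫ x, f i x ^ (2 * p) ∂(gaussianReal 0 1) ≤ 1) →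
      ∫ ω, (∑ i, f i (z ω i / √(Cov i i))) ^ (2 * p) ∂P ≤
        C * (1 + ∑ i, ∑ j, offDiagCorrSq Cov i j) * (Fintype.card ι : ℝ) ^ (2 * p - 2) := by
  obtain ⟨C, hC, H⟩ := exists_abs_integral_prod_tuple_le p hp
  set K : ℝ := (2 * p : ℝ) * (2 * p) ^ (2 * p) with hK
  have hK0 : 0 ≤ K := by positivity
  refine ⟨K + C * (2 * p) ^ 2, by positivity,
    fun ι _ _ Cov hCov hdiag Ω mΩ P z hz f hf hf0 hfi hf1 => ?_⟩
  have hr := offDiagCorrSq_nonneg hCov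
  have hlaw := hasLaw_eval_div_sqrt hCov hdiag hz
  set Y : ι → Ω → ℝ := fun i ω => f i (z ω i / √(Cov i i)) with hYdef
  have hY : ∀ i, AEStronglyMeasurable (Y i) P := fun i =>
    AEStronglyMeasurable.comp_aemeasurable ((hlaw i).map_eq ▸ hf i) (hlaw i).aemeasurable
  have hpow : ∀ i, AEStronglyMeasurable (fun x => f i x ^ (2 * p)) (gaussianReal 0 1) :=
    fun i => (hf i).pow _
  have hint : ∀ i, Integrable (fun ω => Y i ω ^ (2 * p)) P := fun i =>
    Integrable.comp_aemeasurable (g := fun x => f i x ^ (2 * p)) ((hlaw i).map_eq ▸ hfi i)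
      (hlaw i).aemeasurable
  have hY1 : ∀ i, ∫ ω, Y i ω ^ (2 * p) ∂P ≤ 1 := fun i =>
    ((hlaw i).integral_comp (hpow i)).trans_le (hf1 i)
  have hprod := fun t => integrable_prod_of_integrable_pow (by omega) hY hint t
  set W : (Fin (2 * p) → ι) → ℝ := fun t => ∑ a, ∑ b, offDiagCorrSq Cov (t a) (t b) with hW
  have hW0 : ∀ t, 0 ≤ W t := fun t => Finset.sum_nonneg fun a _ => Finset.sum_nonneg fun b _ =>
    hr _ _
  -- The trivial bound `2p` for tuples with two or more coincidences, the correlation bound for the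
  -- rest.
  have hterm : ∀ t : Fin (2 * p) → ι, ∫ ω, ∏ a, Y (t a) ω ∂P ≤
      (if (Finset.univ.image t).card + 2 ≤ 2 * p then (2 * p : ℝ) else 0) + C * W t := by
    intro t
    refine (le_abs_self _).trans ?_
    split_ifs with ht
    · refine ((hprod t).2.trans (Finset.sum_le_sum fun a _ => hY1 (t a))).trans ?_
      have := mul_nonneg hC (hW0 t)
      simp only [Finset.sum_const, Finset.card_univ, Fintype.card_fin, nsmul_eq_mul, mul_one]
      push_cast
      linarith
    · rw [zero_add]
      exact H ι Cov hCov hdiag hz f hf hf0 hfi hf1 t (by omega)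
  have hsumW : ∑ t, W t ≤ (2 * p : ℝ) ^ 2 *
      ((Fintype.card ι : ℝ) ^ (2 * p - 2) * ∑ i, ∑ j, offDiagCorrSq Cov i j) := by
    simp only [hW]
    rw [Finset.sum_comm]
    simp_rw [Finset.sum_comm (s := (Finset.univ : Finset (Fin (2 * p) → ι)))]
    have h1 : ∀ a b : Fin (2 * p), ∑ t : Fin (2 * p) → ι, offDiagCorrSq Cov (t a) (t b) ≤
        (Fintype.card ι : ℝ) ^ (2 * p - 2) * ∑ i, ∑ j, offDiagCorrSq Cov i j := by
      intro a b
      by_cases hab : a = b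
      · subst hab
        have : ∑ t : Fin (2 * p) → ι, offDiagCorrSq Cov (t a) (t a) = 0 :=
          Finset.sum_eq_zero fun t _ => by simp [offDiagCorrSq]
        rw [this]
        exact mul_nonneg (by positivity) (Finset.sum_nonneg fun i _ => Finset.sum_nonneg
          fun j _ => hr i j)
      · exact (sum_tuple_eval_two _ hab).le
    refine (Finset.sum_le_sum fun a _ => Finset.sum_le_sum fun b _ => h1 a b).trans (le_of_eq ?_)
    simp only [Finset.sum_const, Finset.card_univ, Fintype.card_fin, nsmul_eq_mul]
    push_cast
    ring
  simp_rw [Fintype.sum_pow]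
  rw [integral_finsetSum _ fun t _ => (hprod t).1]
  refine (Finset.sum_le_sum fun t _ => hterm t).trans ?_
  rw [Finset.sum_add_distrib, ← Finset.mul_sum, ← Finset.sum_filter, Finset.sum_const,
    nsmul_eq_mul]
  have hcnt : (((Finset.univ : Finset (Fin (2 * p) → ι)).filter
      fun t => (Finset.univ.image t).card + 2 ≤ 2 * p).card : ℝ) ≤
      (2 * p) ^ (2 * p) * (Fintype.card ι : ℝ) ^ (2 * p - 2) := by
    exact_mod_cast card_filter_card_image_add_two_le (2 * p) ι
  set r := ∑ i, ∑ j, offDiagCorrSq Cov i j with hrdef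
  have hr0 : 0 ≤ r := Finset.sum_nonneg fun i _ => Finset.sum_nonneg fun j _ => hr i j
  set M := (Fintype.card ι : ℝ) ^ (2 * p - 2) with hM
  have hM0 : 0 ≤ M := by positivity
  calc _ ≤ (2 * p : ℝ) ^ (2 * p) * M * (2 * p) + C * ((2 * p : ℝ) ^ 2 * (M * r)) :=
        add_le_add (mul_le_mul_of_nonneg_right hcnt (by positivity))
          (mul_le_mul_of_nonneg_left hsumW hC)
    _ = K * M + C * (2 * p) ^ 2 * (M * r) := by rw [hK]; ring
    _ ≤ (K + C * (2 * p) ^ 2) * (1 + r) * M := by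
        have h1 : 0 ≤ K * (M * r) := by positivity
        have h2 : 0 ≤ C * (2 * p : ℝ) ^ 2 * M := by positivity
        nlinarith

/-! ### Rescaling and conclusion -/

theorem sum_offDiagCorrSq_eq {n : ℕ} {Cov : Matrix (Fin n) (Fin n) ℝ} (hCov : Cov.PosSemidef) :
    ∑ i, ∑ j, offDiagCorrSq Cov i j =
      2 * ∑ i, ∑ j ∈ Finset.Ioi i, Cov i j ^ 2 / (Cov i i * Cov j j) := by
  have hsymm : ∀ i j, Cov i j = Cov j i := fun i j => by
    simpa using (hCov.isHermitian.apply i j).symm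
  set h : Fin n → Fin n → ℝ := fun i j =>
    if i < j then Cov i j ^ 2 / (Cov i i * Cov j j) else 0 with hh
  have h1 : ∀ i j, offDiagCorrSq Cov i j = h i j + h j i := by
    intro i j
    rcases lt_trichotomy i j with hij | rfl | hij
    · simp [offDiagCorrSq, hh, hij, hij.ne, hij.not_gt]
    · simp [offDiagCorrSq, hh]
    · simp [offDiagCorrSq, hh, hij, hij.ne', hij.not_gt, hsymm i j, mul_comm]
  have h2 : ∀ i, ∑ j ∈ Finset.Ioi i, Cov i j ^ 2 / (Cov i i * Cov j j) = ∑ j, h i j := by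
    intro i
    rw [hh, ← Finset.sum_filter]
    congr 1
    ext j
    simp
  simp_rw [h1, h2, Finset.sum_add_distrib]
  rw [Finset.sum_comm (f := fun i j => h j i)]
  ring

theorem integrable_sum_pow {α ι : Type*} [Fintype ι] {mα : MeasurableSpace α} {μ : Measure α}
    {p : ℕ} (hp : 1 ≤ p) {Y : ι → α → ℝ} (hY : ∀ i, AEStronglyMeasurable (Y i) μ)
    (hint : ∀ i, Integrable (fun ω => Y i ω ^ (2 * p)) μ) :
    Integrable (fun ω => (∑ i, Y i ω) ^ (2 * p)) μ := by
  simp_rw [Fintype.sum_pow]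
  exact integrable_finsetSum _ fun t _ => (integrable_prod_of_integrable_pow hp hY hint t).1

/-- Homogeneity reduces to the normalized case: coordinates are divided by their standard deviations
and functions by `M' ^ (1 / (2p))`. Working with `M' > M` and letting `M'` decrease to `M` covers `M
= 0`. -/
theorem exists_integral_sum_centered_pow_le (p : ℕ) (hp : 3 ≤ p) :
    ∃ C : ℝ, 0 ≤ C ∧ ∀ (ι : Type) [Fintype ι] [DecidableEq ι] (Cov : Matrix ι ι ℝ),
      Cov.PosSemidef → (∀ i, Cov i i ≠ 0) →
      ∀ {Ω : Type*} {_ : MeasurableSpace Ω} {P : Measure Ω} {z : Ω → EuclideanSpace ℝ ι},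
      HasLaw z (multivariateGaussian 0 Cov) P →
      ∀ ψ : ι → ℝ → ℝ, (∀ i, AEMeasurable (ψ i) (P.map fun ω => z ω i)) →
      (∀ i, ∫ ω, ψ i (z ω i) ∂P = 0) →
      (∀ i, Integrable (fun ω => ψ i (z ω i) ^ (2 * p)) P) →
      ∀ M : ℝ, (∀ i, ∫ ω, ψ i (z ω i) ^ (2 * p) ∂P ≤ M) → 0 ≤ M →
      ∫ ω, (∑ i, ψ i (z ω i)) ^ (2 * p) ∂P ≤
        C * (1 + ∑ i, ∑ j, offDiagCorrSq Cov i j) * (Fintype.card ι : ℝ) ^ (2 * p - 2) * M := by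
  obtain ⟨C, hC, H⟩ := exists_integral_sum_pow_le p hp
  refine ⟨C, hC, fun ι _ _ Cov hCov hdiag Ω mΩ P z hz ψ hψ hψ0 hψi M hM hM0 => ?_⟩
  set A := C * (1 + ∑ i, ∑ j, offDiagCorrSq Cov i j) * (Fintype.card ι : ℝ) ^ (2 * p - 2) with hA
  have hσ : ∀ i, √(Cov i i) ≠ 0 := fun i =>
    (Real.sqrt_pos.2 (lt_of_le_of_ne hCov.diag_nonneg (hdiag i).symm)).ne'
  have hlaw := hasLaw_eval_div_sqrt hCov hdiag hz
  have hzi : ∀ i, P.map (fun ω => z ω i) =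
      (gaussianReal 0 1).map (fun x => √(Cov i i) * x) := fun i => by
    rw [← (hlaw i).map_eq, AEMeasurable.map_map_of_aemeasurable (by fun_prop) (hlaw i).aemeasurable]
    congr 1
    ext ω
    simp only [Function.comp_apply]
    rw [mul_div_cancel₀ _ (hσ i)]
  -- the case of a strictly larger bound
  have key : ∀ M' : ℝ, M < M' → ∫ ω, (∑ i, ψ i (z ω i)) ^ (2 * p) ∂P ≤ A * M' := by
    intro M' hM'
    have hM'0 : 0 < M' := hM0.trans_lt hM'
    set K : ℝ := M' ^ (((2 * p : ℕ) : ℝ)⁻¹) with hK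
    have hKpow : K ^ (2 * p) = M' := Real.rpow_inv_natCast_pow hM'0.le (by omega)
    have hK0 : 0 < K := Real.rpow_pos_of_pos hM'0 _
    set f : ι → ℝ → ℝ := fun i x => ψ i (√(Cov i i) * x) / K with hf
    have hfz : ∀ i ω, f i (z ω i / √(Cov i i)) = ψ i (z ω i) / K := fun i ω => by
      simp only [hf]
      rw [mul_div_cancel₀ _ (hσ i)]
    have hfm : ∀ i, AEStronglyMeasurable (f i) (gaussianReal 0 1) := fun i => by
      have h1 := hψ i
      rw [hzi i] at h1
      exact ((h1.comp_measurable (by fun_prop)).div_const K).aestronglyMeasurable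
    have hint : ∀ (i) (k : ℕ), ∫ x, f i x ^ k ∂(gaussianReal 0 1) =
        (∫ ω, ψ i (z ω i) ^ k ∂P) / K ^ k := fun i k => by
      rw [← (hlaw i).integral_comp (f := fun x => f i x ^ k) ((hfm i).pow k), ← integral_div]
      simp only [Function.comp_def, hfz, div_pow]
    have h1 := H ι Cov hCov hdiag hz f hfm
      (fun i => by simpa [hψ0] using hint i 1)
      (fun i => by
        rw [← (hlaw i).map_eq]
        refine (integrable_map_measure ((hlaw i).map_eq ▸ (hfm i).pow (2 * p))
          (hlaw i).aemeasurable).2 ?_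
        simp only [Function.comp_def, hfz, div_pow]
        exact (hψi i).div_const _)
      (fun i => by
        rw [hint i, hKpow, div_le_one hM'0]
        exact (hM i).trans hM'.le)
    simp_rw [hfz, ← Finset.sum_div, div_pow, hKpow] at h1
    rwa [integral_div, div_le_iff₀ hM'0] at h1
  have hlim : Filter.Tendsto (fun M' => A * M') (nhdsWithin M (Set.Ioi M)) (nhds (A * M)) :=
    ((continuous_const_mul A).tendsto M).mono_left nhdsWithin_le_nhds
  exact ge_of_tendsto hlim (Filter.eventually_of_mem self_mem_nhdsWithin key)

/-- Jensen's inequality for the convex function `x ↦ x ^ L` on the nonnegative reals. -/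
theorem integral_pow_le_integral_abs_rpow {α : Type*} {mα : MeasurableSpace α} {μ : Measure α}
    [IsProbabilityMeasure μ] {f : α → ℝ} {p : ℕ} {L : ℝ} (hL : 1 < L)
    (hf : Integrable (fun x => f x ^ (2 * p)) μ)
    (hfL : Integrable (fun x => |f x| ^ (2 * (p : ℝ) * L)) μ) :
    ∫ x, f x ^ (2 * p) ∂μ ≤ (∫ x, |f x| ^ (2 * (p : ℝ) * L) ∂μ) ^ (1 / L) := by
  have h0 : ∀ x, 0 ≤ f x ^ (2 * p) := fun x => (even_two_mul p).pow_nonneg _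
  have hpow : ∀ x, (f x ^ (2 * p)) ^ L = |f x| ^ (2 * (p : ℝ) * L) := fun x => by
    rw [Real.rpow_mul (abs_nonneg _), ← (even_two_mul p).pow_abs]
    congr 1
    exact_mod_cast (Real.rpow_natCast |f x| (2 * p)).symm
  have h1 := (convexOn_rpow hL.le).map_integral_le (μ := μ) (f := fun x => f x ^ (2 * p))
    (Real.continuous_rpow_const (by linarith)).continuousOn isClosed_Ici
    (Filter.Eventually.of_forall h0) hf (by simpa only [Function.comp_def, hpow] using hfL)
  simp_rw [hpow] at h1
  rw [one_div, Real.le_rpow_inv_iff_of_pos (integral_nonneg h0)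
    (integral_nonneg fun x => by positivity) (by linarith)]
  exact h1

theorem mainTheorem4 (p : ℕ) (hp : 6 ≤ p) (R : ℝ) :
    ∃ C : ℝ, ∀ (n : ℕ) (_ : 1 ≤ n)
      (Cov : Matrix (Fin n) (Fin n) ℝ) (_ : Cov.PosSemidef) (_ : ∀ i, Cov i i ≠ 0)
      (_ : ∑ i, ∑ j ∈ Finset.Ioi i, Cov i j ^ 2 / (Cov i i * Cov j j) ≤ R)
      (Ω : Type*) (_ : MeasurableSpace Ω) (P : Measure Ω) (_ : IsProbabilityMeasure P)
      (z : Ω → EuclideanSpace ℝ (Fin n)) (_ : HasLaw z (multivariateGaussian 0 Cov) P)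
      (φ : Fin n → ℝ → ℝ) (_ : ∀ i, AEMeasurable (φ i) (P.map fun ω => z ω i))
      (μ : Fin n → ℝ) (_ : ∀ i, Integrable (fun ω => φ i (z ω i)) P)
      (_ : ∀ i, μ i = ∫ ω, φ i (z ω i) ∂P)
      (_ : ∀ i, Integrable (fun ω => (φ i (z ω i) - μ i) ^ (2 * p)) P)
      (Q : Ω → ℝ) (_ : ∀ ω, Q ω = 1 / (n : ℝ) * ∑ i, φ i (z ω i)),
      Integrable Q P ∧
      Integrable (fun ω => (Q ω - ∫ ω', Q ω' ∂P) ^ (2 * p)) P ∧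
      (∫ ω, (Q ω - ∫ ω', Q ω' ∂P) ^ (2 * p) ∂P
        ≤ C * (n : ℝ) ^ (-1.5 : ℝ) * ⨆ i, ∫ ω, (φ i (z ω i) - μ i) ^ (2 * p) ∂P) ∧
      ∀ L : ℝ, 1 < L →
        (∀ i, Integrable (fun ω => |φ i (z ω i) - μ i| ^ (2 * (p : ℝ) * L)) P) →
        ∫ ω, (Q ω - ∫ ω', Q ω' ∂P) ^ (2 * p) ∂P
          ≤ C * (n : ℝ) ^ (-1.5 + 1 / L : ℝ) *
            (1 / (n : ℝ) * ∑ i, ∫ ω, |φ i (z ω i) - μ i| ^ (2 * (p : ℝ) * L) ∂P) ^ (1 / L) := by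
  obtain ⟨C₀, hC₀, H⟩ := exists_integral_sum_centered_pow_le p (by omega)
  -- The factor 2 passes from unordered to ordered pairs; `|R|` keeps the constant nonnegative for
  -- every real `R`.
  refine ⟨C₀ * (1 + 2 * |R|), ?_⟩
  intro n hn Cov hCov hdiag hR Ω mΩ P hP z hz φ hφ μ hφi hμ hφp Q hQ
  have hn0 : (0 : ℝ) < n := by exact_mod_cast hn
  have : Nonempty (Fin n) := ⟨⟨0, hn⟩⟩
  set C := C₀ * (1 + 2 * |R|) with hC
  have hC0 : 0 ≤ C := by positivity
  have hQint : Integrable Q P := by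
    rw [show Q = fun ω => 1 / (n : ℝ) * ∑ i, φ i (z ω i) from funext hQ]
    exact (integrable_finsetSum _ fun i _ => hφi i).const_mul _
  have hQmean : ∫ ω, Q ω ∂P = 1 / (n : ℝ) * ∑ i, μ i := by
    simp_rw [hQ]
    rw [integral_const_mul, integral_finsetSum _ fun i _ => hφi i]
    simp_rw [hμ]
  have hQS : ∀ ω, (Q ω - ∫ ω', Q ω' ∂P) ^ (2 * p) =
      (∑ i, (φ i (z ω i) - μ i)) ^ (2 * p) / (n : ℝ) ^ (2 * p) := fun ω => by
    rw [hQmean, hQ, ← mul_sub, ← Finset.sum_sub_distrib, mul_pow, div_pow, one_pow]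
    ring
  have hSint : Integrable (fun ω => (∑ i, (φ i (z ω i) - μ i)) ^ (2 * p)) P :=
    integrable_sum_pow (by omega)
      (fun i => ((hφi i).sub (integrable_const _)).aestronglyMeasurable) hφp
  set M := ⨆ i, ∫ ω, (φ i (z ω i) - μ i) ^ (2 * p) ∂P with hM
  have hMle : ∀ i, ∫ ω, (φ i (z ω i) - μ i) ^ (2 * p) ∂P ≤ M := fun i =>
    le_ciSup (f := fun i => ∫ ω, (φ i (z ω i) - μ i) ^ (2 * p) ∂P) (Set.finite_range _).bddAbove i
  have hM0 : 0 ≤ M := Real.iSup_nonneg fun i => integral_nonneg fun ω =>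
    (even_two_mul p).pow_nonneg _
  have hmain : ∫ ω, (Q ω - ∫ ω', Q ω' ∂P) ^ (2 * p) ∂P ≤ C * (n : ℝ) ^ (-1.5 : ℝ) * M := by
    have h1 := H (Fin n) Cov hCov hdiag hz (fun i x => φ i x - μ i)
      (fun i => (hφ i).sub_const _)
      (fun i => by
        rw [integral_sub (hφi i) (integrable_const _), ← hμ i]
        simp) hφp M hMle hM0
    rw [sum_offDiagCorrSq_eq hCov, Fintype.card_fin] at h1
    have hCle : C₀ * (1 + 2 * ∑ i, ∑ j ∈ Finset.Ioi i, Cov i j ^ 2 / (Cov i i * Cov j j)) ≤ C := by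
      refine mul_le_mul_of_nonneg_left ?_ hC₀
      linarith [hR.trans (le_abs_self R)]
    simp_rw [hQS]
    rw [integral_div, div_le_iff₀ (by positivity)]
    refine h1.trans ?_
    -- The argument yields exponent `-2`; it is weakened to `-1.5` because `n ≥ 1`.
    have hnpow : (n : ℝ) ^ (2 * p - 2) ≤ (n : ℝ) ^ (-1.5 : ℝ) * (n : ℝ) ^ (2 * p) := by
      rw [← Real.rpow_natCast, ← Real.rpow_natCast, ← Real.rpow_add hn0]
      refine Real.rpow_le_rpow_of_exponent_le (by exact_mod_cast hn) ?_
      rw [Nat.cast_sub (by omega)]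
      push_cast
      linarith
    calc _ ≤ C * ((n : ℝ) ^ (-1.5 : ℝ) * (n : ℝ) ^ (2 * p)) * M := by gcongr
      _ = _ := by ring
  refine ⟨hQint, ?_, hmain, fun L hL hφL => hmain.trans ?_⟩
  · simp_rw [hQS]
    exact hSint.div_const _
  have hL0 : 0 < L := by linarith
  set V := ∑ i, ∫ ω, |φ i (z ω i) - μ i| ^ (2 * (p : ℝ) * L) ∂P with hV
  have hterm : ∀ i, 0 ≤ ∫ ω, |φ i (z ω i) - μ i| ^ (2 * (p : ℝ) * L) ∂P := fun i =>
    integral_nonneg fun ω => by positivity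
  have hV0 : 0 ≤ V := Finset.sum_nonneg fun i _ => hterm i
  -- The maximum is bounded by the whole sum `V`; writing `V` as `n` times the average then costs
  -- the factor `n ^ (1 / L)`.
  have hMV : M ≤ V ^ (1 / L) := ciSup_le fun i =>
    (integral_pow_le_integral_abs_rpow hL (hφp i) (hφL i)).trans
      (Real.rpow_le_rpow (hterm i) (Finset.single_le_sum (f := fun i =>
        ∫ ω, |φ i (z ω i) - μ i| ^ (2 * (p : ℝ) * L) ∂P) (fun i _ => hterm i)
        (Finset.mem_univ i)) (by positivity))
  calc C * (n : ℝ) ^ (-1.5 : ℝ) * M ≤ C * (n : ℝ) ^ (-1.5 : ℝ) * V ^ (1 / L) :=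
        mul_le_mul_of_nonneg_left hMV (by positivity)
    _ = C * (n : ℝ) ^ (-1.5 + 1 / L : ℝ) * (1 / (n : ℝ) * V) ^ (1 / L) := by
        have : (1 / (n : ℝ) * V) ^ (1 / L) = ((n : ℝ) ^ (1 / L))⁻¹ * V ^ (1 / L) := by
          rw [Real.mul_rpow (by positivity) hV0, one_div (n : ℝ), Real.inv_rpow hn0.le]
        rw [this, Real.rpow_add hn0]
        have : (n : ℝ) ^ (1 / L) ≠ 0 := (Real.rpow_pos_of_pos hn0 _).ne'
        field_simp
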